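/- **Theorem 3.2.** Let $V$ be a $7$-dimensional real vector space. A $3$-form $\phi\in\Lambda^3V^*$ is called *nondegenerate* if for every pair of linearly independent vectors $u,v\in V$ there is a vector $w\in V$ with $\phi(u,v,w)\neq 0$. An inner product $\langle\cdot,\cdot\rangle$ on $V$ is called *compatible* with $\phi$ if the bilinear map $V\times V\to V$, $(u,v)\mapsto u\times v$, defined by $\phi(u,v,w)=\langle u\times v,w\rangle$ for all $u,v,w\in V$, is a cross product, i.e. it is skew-symmetric and satisfies $$\langle u\times v,u\rangle=\langle u\times v,v\rangle=0,\qquad |u\times v|^2=|u|^2|v|^2-\langle u,v\rangle^2$$ for all $u,v\in V$. Let $\phi,\phi'\in\Lambda^3V^*$. Then the following holds. (i) $\phi$ is nondegenerate if and only if it admits a compatible inner product. (ii) The inner product in (i), if it exists, is uniquely determined by $\phi$. (iii) If $\phi$ and $\phi'$ are nondegenerate, then there is a linear automorphism $g$ of $V$ such that $g^*\phi=\phi'$, i.e. $\phi(gu,gv,gw)=\phi'(u,v,w)$ for all $u,v,w\in V$. -/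

import Mathlib

/-- An inner product on a real vector space: a symmetric positive definite bilinear form. -/
structure IsInnerProduct {V : Type*} [AddCommGroup V] [Module ℝ V]
    (B : V →ₗ[ℝ] V →ₗ[ℝ] ℝ) : Prop where
  symm : ∀ u v : V, B u v = B v u
  pos : ∀ u : V, u ≠ 0 → 0 < B u u

/-- A skew-symmetric bilinear map `(u, v) ↦ u × v` is a cross product for the inner product `B`
if `⟨u × v, u⟩ = ⟨u × v, v⟩ = 0` and `|u × v|² = |u|² |v|² - ⟨u, v⟩²`. -/
structure IsCrossProduct {V : Type*} [AddCommGroup V] [Module ℝ V]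
    (B : V →ₗ[ℝ] V →ₗ[ℝ] ℝ) (cross : V →ₗ[ℝ] V →ₗ[ℝ] V) : Prop where
  skew : ∀ u v : V, cross u v = -cross v u
  orth_left : ∀ u v : V, B (cross u v) u = 0
  orth_right : ∀ u v : V, B (cross u v) v = 0
  area : ∀ u v : V, B (cross u v) (cross u v) = B u u * B v v - B u v ^ 2

/-- A 3-form is nondegenerate if no two linearly independent vectors annihilate it. -/
def IsNondegenerateThreeForm {V : Type*} [AddCommGroup V] [Module ℝ V]
    (φ : V [⋀^Fin 3]→ₗ[ℝ] ℝ) : Prop :=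
  ∀ u v : V, LinearIndependent ℝ ![u, v] → ∃ w : V, φ ![u, v, w] ≠ 0

/-- `B` is an inner product compatible with the 3-form `φ`: the bilinear map `(u, v) ↦ u × v`
determined by `φ(u, v, w) = ⟨u × v, w⟩` is a cross product for `B`.
(Since `B` is positive definite, this equation has at most one solution `cross`.) -/
def IsCompatibleInnerProduct {V : Type*} [AddCommGroup V] [Module ℝ V]
    (φ : V [⋀^Fin 3]→ₗ[ℝ] ℝ) (B : V →ₗ[ℝ] V →ₗ[ℝ] ℝ) : Prop :=
  IsInnerProduct B ∧
    ∃ cross : V →ₗ[ℝ] V →ₗ[ℝ] V,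
      (∀ u v w : V, φ ![u, v, w] = B (cross u v) w) ∧ IsCrossProduct B cross

/-! Every nondegenerate form has the same matrix in a suitable frame. `exists_hasFrameForm` starts
from three vectors on which φ is nonzero and extends them to a frame in which most values of φ are
fixed. Linear substitutions then remove the other parameters, while nondegeneracy, in the form
`HasFrameForm.dependent`, makes the pivots nonzero and fixes their signs. This gives (iii) at once,
and pulling back the dot product of ℝ⁷ gives existence in (i). Conversely, testing φ on u, v, u × v
gives the Gram determinant.

For (ii), diagonalize one compatible inner product relative to another. The product of orthogonal
eigenvectors with eigenvalues s, t has eigenvalue (st)⁻¹ (`cross_eigenvector`). Anti-associativity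
on suitable triples then makes eigenvalues equal (`eigenvalue_eq_of_triple`), and s = s⁻² leaves
only s = 1. -/

/-- The `3 × 3` minor of the matrix with rows `x, y, z` on the columns `i, j, k`. -/
def minorThree (x y z : Fin 7 → ℝ) (i j k : Fin 7) : ℝ :=
  x i * (y j * z k - y k * z j) - x j * (y i * z k - y k * z i) + x k * (y i * z j - y j * z i)

/-- The 3-form on `ℝ⁷` with coordinates `e₀, e₁, e₂, h, g₀, g₁, g₂` satisfying
`φ(e₀, e₁, e₂) = c`, `φ(eᵢ, eⱼ, h) = φ(eᵢ, eⱼ, gₖ) = 0`, `φ(eᵢ, h, gⱼ) = δᵢⱼ`, while `m`, `b`, `d`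
record the values on `(eᵢ, gⱼ, gₖ)`, `(h, gⱼ, gₖ)` and `(g₀, g₁, g₂)`. -/
def frameForm (c : ℝ) (m : Matrix (Fin 3) (Fin 3) ℝ) (b : Fin 3 → ℝ) (d : ℝ)
    (x y z : Fin 7 → ℝ) : ℝ :=
  c * minorThree x y z 0 1 2 +
    (minorThree x y z 0 3 4 + minorThree x y z 1 3 5 + minorThree x y z 2 3 6) +
    (m 0 0 * minorThree x y z 0 5 6 + m 0 1 * minorThree x y z 0 6 4 +
      m 0 2 * minorThree x y z 0 4 5) +
    (m 1 0 * minorThree x y z 1 5 6 + m 1 1 * minorThree x y z 1 6 4 +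
      m 1 2 * minorThree x y z 1 4 5) +
    (m 2 0 * minorThree x y z 2 5 6 + m 2 1 * minorThree x y z 2 6 4 +
      m 2 2 * minorThree x y z 2 4 5) +
    (b 0 * minorThree x y z 3 5 6 + b 1 * minorThree x y z 3 6 4 +
      b 2 * minorThree x y z 3 4 5) +
    d * minorThree x y z 4 5 6

/-- `φ` takes the shape `frameForm c m b d` in suitable coordinates. -/
def HasFrameForm {V : Type*} [AddCommGroup V] [Module ℝ V] (φ : V [⋀^Fin 3]→ₗ[ℝ] ℝ)
    (c : ℝ) (m : Matrix (Fin 3) (Fin 3) ℝ) (b : Fin 3 → ℝ) (d : ℝ) : Prop :=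
  ∃ L : (Fin 7 → ℝ) →ₗ[ℝ] V, ∀ x y z, φ ![L x, L y, L z] = frameForm c m b d x y z

/-! ### Reduction of a frame to normal form. -/

section FrameForm

variable {V : Type*} [AddCommGroup V] [Module ℝ V] {φ : V [⋀^Fin 3]→ₗ[ℝ] ℝ}

theorem HasFrameForm.transform {c c' d d' : ℝ} {m m' : Matrix (Fin 3) (Fin 3) ℝ}
    {b b' : Fin 3 → ℝ} (h : HasFrameForm φ c m b d) (M : Matrix (Fin 7) (Fin 7) ℝ)
    (hM : ∀ x y z, frameForm c m b d (M.mulVec x) (M.mulVec y) (M.mulVec z) =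
      frameForm c' m' b' d' x y z) : HasFrameForm φ c' m' b' d' := by
  obtain ⟨L, hL⟩ := h
  exact ⟨L ∘ₗ Matrix.toLin' M, fun x y z => by simp [hL, hM]⟩

theorem eq_zero_of_frameForm_eq_zero {c d : ℝ} {m : Matrix (Fin 3) (Fin 3) ℝ} {b : Fin 3 → ℝ}
    (hc : c ≠ 0) {x : Fin 7 → ℝ} (hx : ∀ y z, frameForm c m b d x y z = 0) : x = 0 := by
  have h2 := hx (Pi.single 0 1) (Pi.single 1 1)
  have h0 := hx (Pi.single 1 1) (Pi.single 2 1)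
  have h1 := hx (Pi.single 2 1) (Pi.single 0 1)
  have h4 := hx (Pi.single 0 1) (Pi.single 3 1)
  have h5 := hx (Pi.single 1 1) (Pi.single 3 1)
  have h6 := hx (Pi.single 2 1) (Pi.single 3 1)
  have h3 := hx (Pi.single 0 1) (Pi.single 4 1)
  simp [frameForm, minorThree, hc] at h0 h1 h2 h4 h5 h6
  simp [frameForm, minorThree, h0, h1, h2, h4, h5, h6] at h3
  ext i
  fin_cases i <;> simp [*]

theorem injective_of_frameForm {c d : ℝ} {m : Matrix (Fin 3) (Fin 3) ℝ} {b : Fin 3 → ℝ}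
    (hc : c ≠ 0) {L : (Fin 7 → ℝ) →ₗ[ℝ] V}
    (hL : ∀ x y z, φ ![L x, L y, L z] = frameForm c m b d x y z) : Function.Injective L := by
  rw [injective_iff_map_eq_zero]
  intro x hx
  refine eq_zero_of_frameForm_eq_zero (c := c) (m := m) (b := b) (d := d) hc fun y z => ?_
  rw [← hL, hx]
  exact φ.map_coord_zero 0 rfl

theorem bijective_of_frameForm (hV : Module.finrank ℝ V = 7) {c d : ℝ}
    {m : Matrix (Fin 3) (Fin 3) ℝ} {b : Fin 3 → ℝ} (hc : c ≠ 0) {L : (Fin 7 → ℝ) →ₗ[ℝ] V}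
    (hL : ∀ x y z, φ ![L x, L y, L z] = frameForm c m b d x y z) : Function.Bijective L := by
  have : FiniteDimensional ℝ V := Module.finite_of_finrank_pos (by omega)
  have hinj := injective_of_frameForm hc hL
  exact ⟨hinj, (LinearMap.injective_iff_surjective_of_finrank_eq_finrank (by simp [hV])).1 hinj⟩

/-- This is how nondegeneracy enters the reduction: a forbidden parameter value is refuted by two
explicit vectors that annihilate the form and have a nonzero 2 × 2 minor. -/
theorem HasFrameForm.dependent (hV : Module.finrank ℝ V = 7) {c d : ℝ}
    {m : Matrix (Fin 3) (Fin 3) ℝ} {b : Fin 3 → ℝ}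
    (h : HasFrameForm φ c m b d) (hφ : IsNondegenerateThreeForm φ) (hc : c ≠ 0)
    {u v : Fin 7 → ℝ} (huv : ∀ z, frameForm c m b d u v z = 0) (i j : Fin 7) :
    u i * v j = u j * v i := by
  obtain ⟨L, hL⟩ := h
  obtain ⟨hinj, hsurj⟩ := bijective_of_frameForm hV hc hL
  by_contra hij
  have hli : LinearIndependent ℝ ![L u, L v] := by
    rw [LinearIndependent.pair_iff]
    intro s t hst
    rw [← map_smul, ← map_smul, ← map_add, map_eq_zero_iff L hinj] at hst
    have hi := congrFun hst i
    have hj := congrFun hst j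
    simp only [Pi.add_apply, Pi.smul_apply, smul_eq_mul, Pi.zero_apply] at hi hj
    have hne : u i * v j - u j * v i ≠ 0 := sub_ne_zero.2 hij
    constructor
    · refine (mul_eq_zero.1 ?_).resolve_right hne
      linear_combination v j * hi - v i * hj
    · refine (mul_eq_zero.1 ?_).resolve_right hne
      linear_combination u i * hj - u j * hi
  obtain ⟨w, hw⟩ := hφ _ _ hli
  obtain ⟨z, rfl⟩ := hsurj w
  exact hw (by rw [hL, huv])

theorem HasFrameForm.exists_b_eq_zero {c d : ℝ} {m : Matrix (Fin 3) (Fin 3) ℝ} {b : Fin 3 → ℝ}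
    (h : HasFrameForm φ c m b d) : ∃ m' d', HasFrameForm φ c m' 0 d' := by
  refine ⟨!![m 0 0 + b 0 * b 0 * c / 4, m 0 1 + b 0 * b 1 * c / 4, m 0 2 + b 0 * b 2 * c / 4;
    m 1 0 + b 0 * b 1 * c / 4, m 1 1 + b 1 * b 1 * c / 4, m 1 2 + b 1 * b 2 * c / 4;
    m 2 0 + b 0 * b 2 * c / 4, m 2 1 + b 1 * b 2 * c / 4, m 2 2 + b 2 * b 2 * c / 4],
    d + (b 0 * (m 2 1 - m 1 2) + b 1 * (m 0 2 - m 2 0) + b 2 * (m 1 0 - m 0 1)) / 2,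
    -- Adding multiples of the eᵢ to the gⱼ cancels b; replacing eᵢ by eᵢ + (c bᵢ / 2) h keeps φ(eᵢ,
    -- eⱼ, gₖ) = 0.
    h.transform !![1, 0, 0, 0, 0, -b 2 / 2, b 1 / 2;
      0, 1, 0, 0, b 2 / 2, 0, -b 0 / 2;
      0, 0, 1, 0, -b 1 / 2, b 0 / 2, 0;
      c * b 0 / 2, c * b 1 / 2, c * b 2 / 2, 1, 0, 0, 0;
      0, 0, 0, 0, 1, 0, 0;
      0, 0, 0, 0, 0, 1, 0;
      0, 0, 0, 0, 0, 0, 1] fun x y z => ?_⟩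
  simp [frameForm, minorThree, Matrix.mulVec, dotProduct, Fin.sum_univ_succ]
  ring

theorem HasFrameForm.exists_isSymm {c d : ℝ} {m : Matrix (Fin 3) (Fin 3) ℝ}
    (h : HasFrameForm φ c m 0 d) :
    ∃ p q r s t u : ℝ, HasFrameForm φ c !![p, s, t; s, q, u; t, u, r] 0 d := by
  refine ⟨m 0 0, m 1 1, m 2 2, (m 0 1 + m 1 0) / 2, (m 0 2 + m 2 0) / 2, (m 1 2 + m 2 1) / 2,
    -- Since φ(eᵢ, h, gⱼ) = δᵢⱼ, adding multiples of h to the gⱼ changes m by an arbitrary skew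
    -- matrix.
    h.transform !![1, 0, 0, 0, 0, 0, 0;
      0, 1, 0, 0, 0, 0, 0;
      0, 0, 1, 0, 0, 0, 0;
      0, 0, 0, 1, (m 2 1 - m 1 2) / 2, (m 0 2 - m 2 0) / 2, (m 1 0 - m 0 1) / 2;
      0, 0, 0, 0, 1, 0, 0;
      0, 0, 0, 0, 0, 1, 0;
      0, 0, 0, 0, 0, 0, 1] fun x y z => ?_⟩
  simp [frameForm, minorThree, Matrix.mulVec, dotProduct, Fin.sum_univ_succ]
  ring

theorem HasFrameForm.exists_split (hV : Module.finrank ℝ V = 7) (hφ : IsNondegenerateThreeForm φ)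
    {c d p q r s t u : ℝ} (hc : c ≠ 0)
    (h : HasFrameForm φ c !![p, s, t; s, q, u; t, u, r] 0 d) :
    ∃ q' r' u' : ℝ, HasFrameForm φ c !![p, 0, 0; 0, q', u'; 0, u', r'] 0 d := by
  have hp : p ≠ 0 := by
    rintro rfl
    have := h.dependent hV hφ hc (u := ![1, 0, 0, 0, 0, 0, 0]) (v := ![0, 0, 0, t, 0, 1, 0])
      (fun z => by simp [frameForm, minorThree]) 0 5
    simp at this
  refine ⟨q - s ^ 2 / p, r - t ^ 2 / p, u - s * t / p,
    -- Completing the square on the eᵢ, with the contragredient change on the gⱼ to preserve the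
    -- pairing through h.
    h.transform !![1, -s / p, -t / p, 0, 0, 0, 0;
      0, 1, 0, 0, 0, 0, 0;
      0, 0, 1, 0, 0, 0, 0;
      0, 0, 0, 1, 0, 0, 0;
      0, 0, 0, 0, 1, 0, 0;
      0, 0, 0, 0, s / p, 1, 0;
      0, 0, 0, 0, t / p, 0, 1] fun x y z => ?_⟩
  simp [frameForm, minorThree, Matrix.mulVec, dotProduct, Fin.sum_univ_succ]
  field_simp
  ring

theorem HasFrameForm.exists_diagonal (hV : Module.finrank ℝ V = 7)
    (hφ : IsNondegenerateThreeForm φ) {c d p q r u : ℝ} (hc : c ≠ 0)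
    (h : HasFrameForm φ c !![p, 0, 0; 0, q, u; 0, u, r] 0 d) :
    ∃ r' : ℝ, HasFrameForm φ c !![p, 0, 0; 0, q, 0; 0, 0, r'] 0 d := by
  have hq : q ≠ 0 := by
    rintro rfl
    have := h.dependent hV hφ hc (u := ![0, 1, 0, 0, 0, 0, 0]) (v := ![0, 0, 0, -u, 1, 0, 0])
      (fun z => by simp [frameForm, minorThree]) 1 4
    simp at this
  refine ⟨r - u ^ 2 / q,
    h.transform !![1, 0, 0, 0, 0, 0, 0;
      0, 1, -u / q, 0, 0, 0, 0;
      0, 0, 1, 0, 0, 0, 0;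
      0, 0, 0, 1, 0, 0, 0;
      0, 0, 0, 0, 1, 0, 0;
      0, 0, 0, 0, 0, 1, 0;
      0, 0, 0, 0, 0, u / q, 1] fun x y z => ?_⟩
  simp [frameForm, minorThree, Matrix.mulVec, dotProduct, Fin.sum_univ_succ]
  field_simp
  ring

theorem HasFrameForm.exists_d_eq_zero {c d p q r : ℝ} (hp : p ≠ 0) (hq : q ≠ 0)
    (h : HasFrameForm φ c !![p, 0, 0; 0, q, 0; 0, 0, r] 0 d) :
    ∃ r' : ℝ, HasFrameForm φ c !![p, 0, 0; 0, q, 0; 0, 0, r'] 0 0 := by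
  refine ⟨r + c * d ^ 2 / (4 * p * q),
    -- The changes of g₀ and g₁ each remove d / 2; the multiple of g₂ added to e₂ restores φ(eᵢ, eⱼ,
    -- gₖ) = 0.
    h.transform !![1, 0, 0, 0, -d / (2 * p), 0, 0;
      0, 1, 0, 0, 0, -d / (2 * q), 0;
      0, 0, 1, 0, 0, 0, 0;
      0, 0, 0, 1, 0, 0, 0;
      0, 0, 0, 0, 1, 0, 0;
      0, 0, 0, 0, 0, 1, 0;
      0, 0, c * d / (2 * p * q), 0, 0, 0, 1] fun x y z => ?_⟩
  simp [frameForm, minorThree, Matrix.mulVec, dotProduct, Fin.sum_univ_succ]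
  field_simp
  ring

theorem HasFrameForm.diagonal_ne_zero (hV : Module.finrank ℝ V = 7)
    (hφ : IsNondegenerateThreeForm φ) {c d p q r : ℝ} (hc : c ≠ 0)
    (h : HasFrameForm φ c !![p, 0, 0; 0, q, 0; 0, 0, r] 0 d) : p ≠ 0 ∧ q ≠ 0 ∧ r ≠ 0 := by
  refine ⟨?_, ?_, ?_⟩ <;> rintro rfl
  · have := h.dependent hV hφ hc (u := ![1, 0, 0, 0, 0, 0, 0]) (v := ![0, 0, 0, 0, 0, 1, 0])
      (fun z => by simp [frameForm, minorThree]) 0 5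
    simp at this
  · have := h.dependent hV hφ hc (u := ![0, 1, 0, 0, 0, 0, 0]) (v := ![0, 0, 0, 0, 1, 0, 0])
      (fun z => by simp [frameForm, minorThree]) 1 4
    simp at this
  · have := h.dependent hV hφ hc (u := ![0, 0, 1, 0, 0, 0, 0]) (v := ![0, 0, 0, 0, 1, 0, 0])
      (fun z => by simp [frameForm, minorThree]) 2 4
    simp at this

theorem mul_neg_of_forall_ne_sq_mul {c q : ℝ} (hc : c ≠ 0) (hq : q ≠ 0)
    (h : ∀ a : ℝ, c ≠ a ^ 2 * q) : c * q < 0 := by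
  by_contra hcq
  have hpos : 0 < c * q := lt_of_le_of_ne (not_lt.1 hcq) (mul_ne_zero hc hq).symm
  apply h (√(c / q))
  have hdiv : 0 ≤ c / q := by
    rw [show c / q = c * q / q ^ 2 by field_simp]
    positivity
  rw [Real.sq_sqrt hdiv]
  field_simp

/-- If c = a²p, the vectors e₁ + a g₂ and e₂ + a g₁ annihilate φ: the e₀ terms c and -a²p cancel,
and so do the h terms. The other two signs follow cyclically. -/
theorem HasFrameForm.mul_diagonal_neg (hV : Module.finrank ℝ V = 7)
    (hφ : IsNondegenerateThreeForm φ) {c p q r : ℝ} (hc : c ≠ 0)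
    (h : HasFrameForm φ c !![p, 0, 0; 0, q, 0; 0, 0, r] 0 0) :
    c * p < 0 ∧ c * q < 0 ∧ c * r < 0 := by
  obtain ⟨hp, hq, hr⟩ := h.diagonal_ne_zero hV hφ hc
  refine ⟨mul_neg_of_forall_ne_sq_mul hc hp fun a ha => ?_,
    mul_neg_of_forall_ne_sq_mul hc hq fun a ha => ?_,
    mul_neg_of_forall_ne_sq_mul hc hr fun a ha => ?_⟩
  · have := h.dependent hV hφ hc (u := ![0, 1, 0, 0, 0, 0, a]) (v := ![0, 0, 1, 0, 0, a, 0])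
      (fun z => by simp [frameForm, minorThree]; linear_combination z 0 * ha) 1 2
    simp at this
  · have := h.dependent hV hφ hc (u := ![0, 0, 1, 0, a, 0, 0]) (v := ![1, 0, 0, 0, 0, 0, a])
      (fun z => by simp [frameForm, minorThree]; linear_combination z 1 * ha) 2 0
    simp at this
  · have := h.dependent hV hφ hc (u := ![1, 0, 0, 0, 0, a, 0]) (v := ![0, 1, 0, 0, a, 0, 0])
      (fun z => by simp [frameForm, minorThree]; linear_combination z 2 * ha) 0 1
    simp at this

theorem exists_cube_eq (a : ℝ) : ∃ s : ℝ, s ^ 3 = a := by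
  rcases le_total 0 a with ha | ha
  · exact ⟨a ^ ((3 : ℕ) : ℝ)⁻¹, Real.rpow_inv_natCast_pow ha three_ne_zero⟩
  · refine ⟨-(-a) ^ ((3 : ℕ) : ℝ)⁻¹, ?_⟩
    rw [Odd.neg_pow (by decide), Real.rpow_inv_natCast_pow (neg_nonneg.2 ha) three_ne_zero, neg_neg]

theorem HasFrameForm.normalize {c p q r : ℝ} (hp : c * p < 0) (hq : c * q < 0) (hr : c * r < 0)
    (h : HasFrameForm φ c !![p, 0, 0; 0, q, 0; 0, 0, r] 0 0) :
    HasFrameForm φ (-1) 1 0 0 := by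
  obtain ⟨a, ha, hpa⟩ : ∃ a : ℝ, a ≠ 0 ∧ c * p = -a ^ 2 :=
    ⟨√(-(c * p)), by rw [Real.sqrt_ne_zero'] ; linarith, by rw [Real.sq_sqrt] <;> linarith⟩
  obtain ⟨b, hb, hqb⟩ : ∃ b : ℝ, b ≠ 0 ∧ c * q = -b ^ 2 :=
    ⟨√(-(c * q)), by rw [Real.sqrt_ne_zero'] ; linarith, by rw [Real.sq_sqrt] <;> linarith⟩
  obtain ⟨e, he, hre⟩ : ∃ e : ℝ, e ≠ 0 ∧ c * r = -e ^ 2 :=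
    ⟨√(-(c * r)), by rw [Real.sqrt_ne_zero'] ; linarith, by rw [Real.sq_sqrt] <;> linarith⟩
  have hc : c ≠ 0 := by rintro rfl; simp at hp
  -- The scaling below multiplies c by s³ / (a b e), so this cube root makes it -1; the diagonal
  -- entries then become 1.
  obtain ⟨s, hs⟩ := exists_cube_eq (-(a * b * e) / c)
  have hs0 : s ≠ 0 := by
    rintro rfl
    have : -(a * b * e) / c ≠ 0 :=
      div_ne_zero (neg_ne_zero.2 (mul_ne_zero (mul_ne_zero ha hb) he)) hc
    exact this (by rw [← hs]; simp)
  have hc' : c = -(a * b * e) / s ^ 3 := by rw [hs]; field_simp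
  have hp' : p = a * s ^ 3 / (b * e) := by
    rw [hs]; field_simp; linear_combination hpa
  have hq' : q = b * s ^ 3 / (a * e) := by
    rw [hs]; field_simp; linear_combination hqb
  have hr' : r = e * s ^ 3 / (a * b) := by
    rw [hs]; field_simp; linear_combination hre
  refine h.transform (Matrix.diagonal ![s / a, s / b, s / e, s, a / s ^ 2, b / s ^ 2, e / s ^ 2])
    fun x y z => ?_
  simp [frameForm, minorThree, Matrix.mulVec_diagonal]
  rw [hc', hp', hq', hr']
  field_simp
  ring

end FrameForm

/-! ### Trilinear expansion and construction of the frame. -/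

section ThreeForm

variable {V : Type*} [AddCommGroup V] [Module ℝ V]

theorem threeForm_eq_curryLeft (φ : V [⋀^Fin 3]→ₗ[ℝ] ℝ) (x y z : V) :
    φ ![x, y, z] = ((φ.curryLeft x).curryLeft y).curryLeft z ![] :=
  rfl

/-- A 3-form as an iterated linear map. -/
def trilinearOfThreeForm (φ : V [⋀^Fin 3]→ₗ[ℝ] ℝ) : V →ₗ[ℝ] V →ₗ[ℝ] V →ₗ[ℝ] ℝ :=
  LinearMap.mk₂ ℝ
    (fun x y =>
      { toFun := fun z => φ ![x, y, z]
        map_add' := fun z w => by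
          simp only [threeForm_eq_curryLeft, map_add, AlternatingMap.add_apply]
        map_smul' := fun a z => by
          simp only [threeForm_eq_curryLeft, map_smul, AlternatingMap.smul_apply,
            RingHom.id_apply] })
    (fun x x' y => by
      ext z
      simp only [threeForm_eq_curryLeft, LinearMap.coe_mk, AddHom.coe_mk, map_add,
        LinearMap.add_apply, AlternatingMap.curryLeft_add, AlternatingMap.add_apply])
    (fun a x y => by
      ext z
      simp only [threeForm_eq_curryLeft, LinearMap.coe_mk, AddHom.coe_mk, map_smul,
        LinearMap.smul_apply, AlternatingMap.curryLeft_smul, AlternatingMap.smul_apply])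
    (fun x y y' => by
      ext z
      simp only [threeForm_eq_curryLeft, LinearMap.coe_mk, AddHom.coe_mk, map_add,
        LinearMap.add_apply, AlternatingMap.curryLeft_add, AlternatingMap.add_apply])
    (fun a x y => by
      ext z
      simp only [threeForm_eq_curryLeft, LinearMap.coe_mk, AddHom.coe_mk, map_smul,
        LinearMap.smul_apply, AlternatingMap.curryLeft_smul, AlternatingMap.smul_apply])

theorem trilinearOfThreeForm_apply (φ : V [⋀^Fin 3]→ₗ[ℝ] ℝ) (x y z : V) :
    trilinearOfThreeForm φ x y z = φ ![x, y, z] :=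
  rfl

theorem threeForm_swap_left (φ : V [⋀^Fin 3]→ₗ[ℝ] ℝ) (x y z : V) :
    φ ![x, y, z] = -φ ![y, x, z] := by
  rw [← φ.map_swap _ (show (0 : Fin 3) ≠ 1 by decide)]
  congr 1
  ext i
  fin_cases i <;> rfl

theorem threeForm_swap_right (φ : V [⋀^Fin 3]→ₗ[ℝ] ℝ) (x y z : V) :
    φ ![x, y, z] = -φ ![x, z, y] := by
  rw [← φ.map_swap _ (show (1 : Fin 3) ≠ 2 by decide)]
  congr 1
  ext i
  fin_cases i <;> rfl

theorem threeForm_self_left (φ : V [⋀^Fin 3]→ₗ[ℝ] ℝ) (x z : V) : φ ![x, x, z] = 0 :=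
  φ.map_eq_zero_of_eq _ (i := 0) (j := 1) rfl (by decide)

theorem threeForm_self_right (φ : V [⋀^Fin 3]→ₗ[ℝ] ℝ) (x z : V) : φ ![x, z, z] = 0 :=
  φ.map_eq_zero_of_eq _ (i := 1) (j := 2) rfl (by decide)

theorem threeForm_self_outer (φ : V [⋀^Fin 3]→ₗ[ℝ] ℝ) (x z : V) : φ ![x, z, x] = 0 :=
  φ.map_eq_zero_of_eq _ (i := 0) (j := 2) rfl (by decide)

theorem threeForm_cycle (φ : V [⋀^Fin 3]→ₗ[ℝ] ℝ) (x y z : V) : φ ![x, y, z] = φ ![y, z, x] := by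
  rw [threeForm_swap_left, threeForm_swap_right, neg_neg]

theorem hasFrameForm_of_values (φ : V [⋀^Fin 3]→ₗ[ℝ] ℝ) (v : Fin 7 → V)
    (h013 : φ ![v 0, v 1, v 3] = 0) (h023 : φ ![v 0, v 2, v 3] = 0)
    (h123 : φ ![v 1, v 2, v 3] = 0)
    (h014 : φ ![v 0, v 1, v 4] = 0) (h024 : φ ![v 0, v 2, v 4] = 0)
    (h124 : φ ![v 1, v 2, v 4] = 0)
    (h015 : φ ![v 0, v 1, v 5] = 0) (h025 : φ ![v 0, v 2, v 5] = 0)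
    (h125 : φ ![v 1, v 2, v 5] = 0)
    (h016 : φ ![v 0, v 1, v 6] = 0) (h026 : φ ![v 0, v 2, v 6] = 0)
    (h126 : φ ![v 1, v 2, v 6] = 0)
    (h034 : φ ![v 0, v 3, v 4] = 1) (h035 : φ ![v 0, v 3, v 5] = 0)
    (h036 : φ ![v 0, v 3, v 6] = 0)
    (h134 : φ ![v 1, v 3, v 4] = 0) (h135 : φ ![v 1, v 3, v 5] = 1)
    (h136 : φ ![v 1, v 3, v 6] = 0)
    (h234 : φ ![v 2, v 3, v 4] = 0) (h235 : φ ![v 2, v 3, v 5] = 0)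
    (h236 : φ ![v 2, v 3, v 6] = 1) :
    ∃ m b d, HasFrameForm φ (φ ![v 0, v 1, v 2]) m b d := by
  let t : Fin 7 → Fin 7 → Fin 7 → ℝ := fun i j k => φ ![v i, v j, v k]
  -- The guards orient antisymmetry towards increasing indices, so that the final `simp` terminates.
  have htl : ∀ i j k, j < i → t i j k = -t j i k := fun i j k _ => threeForm_swap_left φ _ _ _
  have htr : ∀ i j k, k < j → t i j k = -t i k j := fun i j k _ => threeForm_swap_right φ _ _ _
  have hsl : ∀ i k, t i i k = 0 := fun i k => threeForm_self_left φ _ _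
  have hsr : ∀ i k, t i k k = 0 := fun i k => threeForm_self_right φ _ _
  have hso : ∀ i k, t i k i = 0 := fun i k => threeForm_self_outer φ _ _
  refine ⟨!![t 0 5 6, -t 0 4 6, t 0 4 5; t 1 5 6, -t 1 4 6, t 1 4 5;
    t 2 5 6, -t 2 4 6, t 2 4 5], ![t 3 5 6, -t 3 4 6, t 3 4 5], t 4 5 6,
    Fintype.linearCombination ℝ v, fun x y z => ?_⟩
  have hsum : φ ![Fintype.linearCombination ℝ v x, Fintype.linearCombination ℝ v y,
      Fintype.linearCombination ℝ v z] =
      ∑ k, z k * ∑ j, y j * ∑ i, x i * t i j k := by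
    rw [← trilinearOfThreeForm_apply]
    simp only [Fintype.linearCombination_apply, map_sum, map_smul, LinearMap.sum_apply,
      LinearMap.smul_apply, smul_eq_mul, trilinearOfThreeForm_apply]
    rfl
  rw [hsum]
  change t 0 1 3 = 0 at h013
  change t 0 2 3 = 0 at h023
  change t 1 2 3 = 0 at h123
  change t 0 1 4 = 0 at h014
  change t 0 2 4 = 0 at h024
  change t 1 2 4 = 0 at h124
  change t 0 1 5 = 0 at h015
  change t 0 2 5 = 0 at h025
  change t 1 2 5 = 0 at h125
  change t 0 1 6 = 0 at h016
  change t 0 2 6 = 0 at h026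
  change t 1 2 6 = 0 at h126
  change t 0 3 4 = 1 at h034
  change t 0 3 5 = 0 at h035
  change t 0 3 6 = 0 at h036
  change t 1 3 4 = 0 at h134
  change t 1 3 5 = 1 at h135
  change t 1 3 6 = 0 at h136
  change t 2 3 4 = 0 at h234
  change t 2 3 5 = 0 at h235
  change t 2 3 6 = 1 at h236
  change _ = frameForm (t 0 1 2) _ _ _ x y z
  clear_value t
  clear hsum
  simp [Fin.sum_univ_seven, *, frameForm, minorThree]
  ring

theorem exists_hasFrameForm (hV : Module.finrank ℝ V = 7) {φ : V [⋀^Fin 3]→ₗ[ℝ] ℝ}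
    (hφ : IsNondegenerateThreeForm φ) :
    ∃ c m b d, c ≠ 0 ∧ HasFrameForm φ c m b d := by
  have : FiniteDimensional ℝ V := Module.finite_of_finrank_pos (by omega)
  let T := trilinearOfThreeForm φ
  let basis := Module.finBasisOfFinrankEq ℝ V hV
  obtain ⟨e, he⟩ : ∃ e : Fin 3 → V, φ ![e 0, e 1, e 2] ≠ 0 := by
    have hli : LinearIndependent ℝ ![basis 0, basis 1] := by
      have := basis.linearIndependent.comp ![0, 1] (by decide)
      convert this using 1
      ext i
      fin_cases i <;> rfl
    obtain ⟨w, hw⟩ := hφ _ _ hli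
    exact ⟨![basis 0, basis 1, w], hw⟩
  let A : V →ₗ[ℝ] (Fin 3 → ℝ) := LinearMap.pi ![T (e 1) (e 2), T (e 2) (e 0), T (e 0) (e 1)]
  obtain ⟨f, hfA, hf⟩ : ∃ f ∈ LinearMap.ker A, f ≠ 0 :=
    (Submodule.ne_bot_iff _).1 (LinearMap.ker_ne_bot_of_finrank_lt (by simp [hV]))
  have hA : ∀ x, A x = ![φ ![e 1, e 2, x], φ ![e 2, e 0, x], φ ![e 0, e 1, x]] := fun x => by
    ext i
    fin_cases i <;> rfl
  have hAf : φ ![e 1, e 2, f] = 0 ∧ φ ![e 2, e 0, f] = 0 ∧ φ ![e 0, e 1, f] = 0 := by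
    rw [LinearMap.mem_ker, hA] at hfA
    exact ⟨congrFun hfA 0, congrFun hfA 1, congrFun hfA 2⟩
  obtain ⟨hf0, hf1, hf2⟩ := hAf
  let W : V →ₗ[ℝ] (Fin 3 → ℝ) := LinearMap.pi fun i => T (e i) f
  have hW : ∀ x i, W x i = φ ![e i, f, x] := fun x i => rfl
  -- Otherwise a nonzero functional kills the image. Evaluating this relation at the `e i` kills the
  -- coefficients `a`; what remains says that `w` and `f` annihilate φ.
  have hsurj : LinearMap.range (A.prod W) = ⊤ := by
    by_contra hne
    obtain ⟨ℓ, hℓ, hker⟩ := Submodule.exists_le_ker_of_lt_top _ (lt_top_iff_ne_top.2 hne)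
    have hsingle : ∀ i : Fin 3, (fun j => if i = j then (1 : ℝ) else 0) = Pi.single i 1 :=
      fun i => by ext j; simp [Pi.single_apply, eq_comm]
    have hℓ_apply : ∀ p q : Fin 3 → ℝ, ℓ (p, q) =
        ∑ i, p i * ℓ (Pi.single i 1, 0) + ∑ i, q i * ℓ (0, Pi.single i 1) := fun p q => by
      have hp := (ℓ ∘ₗ LinearMap.inl ℝ _ _).pi_apply_eq_sum_univ p
      have hq := (ℓ ∘ₗ LinearMap.inr ℝ _ _).pi_apply_eq_sum_univ q
      simp only [LinearMap.comp_apply, LinearMap.inl_apply, LinearMap.inr_apply,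
        smul_eq_mul] at hp hq
      have hpq : (p, q) = (p, 0) + (0, q) := by simp
      rw [hpq, map_add, hp, hq]
      simp only [hsingle]
    set a : Fin 3 → ℝ := fun i => ℓ (Pi.single i 1, 0)
    set b : Fin 3 → ℝ := fun i => ℓ (0, Pi.single i 1)
    have hzero : ∀ x, a 0 * φ ![e 1, e 2, x] + a 1 * φ ![e 2, e 0, x] + a 2 * φ ![e 0, e 1, x] +
        (b 0 * φ ![e 0, f, x] + b 1 * φ ![e 1, f, x] + b 2 * φ ![e 2, f, x]) = 0 := fun x => by
      have h0 : ℓ (A x, W x) = 0 := hker ⟨x, rfl⟩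
      rw [hℓ_apply, hA] at h0
      simp only [Fin.sum_univ_three, hW] at h0
      simpa [mul_comm] using h0
    have hef : ∀ i j, φ ![e i, f, e j] = 0 := fun i j => by
      rw [threeForm_swap_right, neg_eq_zero]
      fin_cases i <;> fin_cases j <;> simp only [Fin.reduceFinMk, Fin.zero_eta, Fin.mk_one]
      all_goals first
        | exact threeForm_self_left φ _ _
        | assumption
        | (rw [threeForm_swap_left, neg_eq_zero]; assumption)
    have ha0 : a 0 = 0 := by
      have := hzero (e 0)
      rw [hef, hef, hef, ← threeForm_cycle, threeForm_self_right, threeForm_self_outer] at this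
      simpa [he] using this
    have ha1 : a 1 = 0 := by
      have := hzero (e 1)
      rw [hef, hef, hef, threeForm_cycle φ (e 2), threeForm_self_outer,
        threeForm_self_right] at this
      simpa [he] using this
    have ha2 : a 2 = 0 := by
      have := hzero (e 2)
      rw [hef, hef, hef, threeForm_self_outer, threeForm_self_right] at this
      simpa [he] using this
    let w : V := b 0 • e 0 + b 1 • e 1 + b 2 • e 2
    have hw : ∀ x, φ ![w, f, x] = 0 := fun x => by
      have := hzero x
      simp only [ha0, ha1, ha2, zero_mul, zero_add] at this
      simpa only [← trilinearOfThreeForm_apply, w, map_add, map_smul, LinearMap.add_apply,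
        LinearMap.smul_apply, smul_eq_mul] using this
    have hdep : ¬ LinearIndependent ℝ ![w, f] := fun hli => by
      obtain ⟨x, hx⟩ := hφ _ _ hli
      exact hx (hw x)
    have hb : b 0 = 0 ∧ b 1 = 0 ∧ b 2 = 0 := by
      rw [LinearIndependent.pair_iff] at hdep
      push Not at hdep
      obtain ⟨s, t, hst, hne⟩ := hdep
      have hs : s ≠ 0 := by
        rintro rfl
        exact hne rfl ((smul_eq_zero.1 (by simpa using hst)).resolve_right hf)
      -- Since `f` lies in the kernel of `A`, these contractions isolate s bᵢ φ(e₀, e₁, e₂).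
      have h0 : T (e 1) (e 2) (s • w + t • f) = 0 := by rw [hst, map_zero]
      have h1 : T (e 2) (e 0) (s • w + t • f) = 0 := by rw [hst, map_zero]
      have h2 : T (e 0) (e 1) (s • w + t • f) = 0 := by rw [hst, map_zero]
      simp only [w, T, map_add, map_smul, trilinearOfThreeForm_apply, hf0, hf1, hf2,
        threeForm_self_outer, threeForm_self_right, ← threeForm_cycle φ (e 0) (e 1) (e 2),
        threeForm_cycle φ (e 2) (e 0) (e 1), smul_eq_mul] at h0 h1 h2
      simp [hs, he] at h0 h1 h2
      exact ⟨h0, h1, h2⟩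
    obtain ⟨hb0, hb1, hb2⟩ := hb
    refine hℓ (LinearMap.ext fun p => ?_)
    obtain ⟨p, q⟩ := p
    rw [hℓ_apply, LinearMap.zero_apply]
    change ∑ i, p i * a i + ∑ i, q i * b i = 0
    simp [Fin.sum_univ_three, ha0, ha1, ha2, hb0, hb1, hb2]
  have hdual : ∀ i, ∃ g, A g = 0 ∧ W g = Pi.single i 1 := fun i => by
    obtain ⟨g, hg⟩ := LinearMap.range_eq_top.1 hsurj (0, Pi.single i 1)
    exact ⟨g, congrArg Prod.fst hg, congrArg Prod.snd hg⟩
  choose g hgA hgW using hdual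
  have hA0 : ∀ i, φ ![e 1, e 2, g i] = 0 := fun i => by
    simpa [hA] using congrFun (hgA i) 0
  have hA1 : ∀ i, φ ![e 0, e 2, g i] = 0 := fun i => by
    rw [threeForm_swap_left]
    simpa [hA] using congrFun (hgA i) 1
  have hA2 : ∀ i, φ ![e 0, e 1, g i] = 0 := fun i => by
    simpa [hA] using congrFun (hgA i) 2
  have hWg : ∀ i j, φ ![e j, f, g i] = (Pi.single i 1 : Fin 3 → ℝ) j := fun i j => by
    rw [← hgW, hW]
  obtain ⟨m, b, d, h⟩ := hasFrameForm_of_values φ ![e 0, e 1, e 2, f, g 0, g 1, g 2]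
    hf2 (by rw [threeForm_swap_left]; exact neg_eq_zero.2 hf1) hf0
    (hA2 0) (hA1 0) (hA0 0) (hA2 1) (hA1 1) (hA0 1) (hA2 2) (hA1 2) (hA0 2)
    ((hWg 0 0).trans (by simp)) ((hWg 1 0).trans (by simp)) ((hWg 2 0).trans (by simp))
    ((hWg 0 1).trans (by simp)) ((hWg 1 1).trans (by simp)) ((hWg 2 1).trans (by simp))
    ((hWg 0 2).trans (by simp)) ((hWg 1 2).trans (by simp)) ((hWg 2 2).trans (by simp))
  exact ⟨_, m, b, d, he, h⟩

end ThreeForm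

/-! ### Consequences of the normal form. -/

section NormalForm

variable {V : Type*} [AddCommGroup V] [Module ℝ V]

theorem IsNondegenerateThreeForm.hasFrameForm (hV : Module.finrank ℝ V = 7)
    {φ : V [⋀^Fin 3]→ₗ[ℝ] ℝ} (hφ : IsNondegenerateThreeForm φ) :
    HasFrameForm φ (-1) 1 0 0 := by
  obtain ⟨c, m, b, d, hc, h⟩ := exists_hasFrameForm hV hφ
  obtain ⟨m, d, h⟩ := h.exists_b_eq_zero
  obtain ⟨p, q, r, s, t, u, h⟩ := h.exists_isSymm
  obtain ⟨q, r, u, h⟩ := h.exists_split hV hφ hc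
  obtain ⟨r, h⟩ := h.exists_diagonal hV hφ hc
  obtain ⟨hp, hq, -⟩ := h.diagonal_ne_zero hV hφ hc
  obtain ⟨r, h⟩ := h.exists_d_eq_zero hp hq
  obtain ⟨hp, hq, hr⟩ := h.mul_diagonal_neg hV hφ hc
  exact h.normalize hp hq hr

/-- All nondegenerate 3-forms on a 7-dimensional space agree in suitable coordinates. -/
theorem IsNondegenerateThreeForm.exists_linearEquiv (hV : Module.finrank ℝ V = 7)
    {φ : V [⋀^Fin 3]→ₗ[ℝ] ℝ} (hφ : IsNondegenerateThreeForm φ) :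
    ∃ L : (Fin 7 → ℝ) ≃ₗ[ℝ] V, ∀ x y z, φ ![L x, L y, L z] = frameForm (-1) 1 0 0 x y z := by
  obtain ⟨L, hL⟩ := hφ.hasFrameForm hV
  exact ⟨LinearEquiv.ofBijective L (bijective_of_frameForm hV (by norm_num) hL), hL⟩

theorem IsNondegenerateThreeForm.exists_compLinearMap_eq (hV : Module.finrank ℝ V = 7)
    {φ φ' : V [⋀^Fin 3]→ₗ[ℝ] ℝ} (hφ : IsNondegenerateThreeForm φ)
    (hφ' : IsNondegenerateThreeForm φ') :
    ∃ g : V ≃ₗ[ℝ] V, φ.compLinearMap (g : V →ₗ[ℝ] V) = φ' := by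
  obtain ⟨L, hL⟩ := hφ.exists_linearEquiv hV
  obtain ⟨L', hL'⟩ := hφ'.exists_linearEquiv hV
  refine ⟨L'.symm.trans L, AlternatingMap.ext fun v => ?_⟩
  have h := hL (L'.symm (v 0)) (L'.symm (v 1)) (L'.symm (v 2))
  have h' := hL' (L'.symm (v 0)) (L'.symm (v 1)) (L'.symm (v 2))
  rw [← h] at h'
  simp only [LinearEquiv.apply_symm_apply] at h'
  rw [AlternatingMap.compLinearMap_apply]
  convert h'.symm using 2
  · ext i
    fin_cases i <;> rfl
  · ext i
    fin_cases i <;> rfl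

theorem IsNondegenerateThreeForm.exists_isCompatibleInnerProduct (hV : Module.finrank ℝ V = 7)
    {φ : V [⋀^Fin 3]→ₗ[ℝ] ℝ} (hφ : IsNondegenerateThreeForm φ) :
    ∃ B : V →ₗ[ℝ] V →ₗ[ℝ] ℝ, IsCompatibleInnerProduct φ B := by
  obtain ⟨L, hL⟩ := hφ.exists_linearEquiv hV
  let B : V →ₗ[ℝ] V →ₗ[ℝ] ℝ := (dotProductBilin ℝ ℝ).compl₁₂ L.symm.toLinearMap L.symm.toLinearMap
  have hB : ∀ u v, B u v = L.symm u ⬝ᵥ L.symm v := fun u v => rfl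
  let T := trilinearOfThreeForm φ
  let cross : V →ₗ[ℝ] V →ₗ[ℝ] V :=
    LinearMap.mk₂ ℝ (fun u v => L fun i => T u v (L (Pi.single i 1)))
      (fun u u' v => by rw [← map_add]; congr 1; ext i; simp)
      (fun a u v => by rw [← map_smul]; congr 1; ext i; simp)
      (fun u v v' => by rw [← map_add]; congr 1; ext i; simp)
      (fun a u v => by rw [← map_smul]; congr 1; ext i; simp)
  have hcross : ∀ u v, cross u v = L fun i => φ ![u, v, L (Pi.single i 1)] := fun u v => rfl
  have hφB : ∀ u v w, φ ![u, v, w] = B (cross u v) w := fun u v w => by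
    have := (T u v ∘ₗ L.toLinearMap).pi_apply_eq_sum_univ (L.symm w)
    have hsingle : ∀ i : Fin 7, (fun j => if i = j then (1 : ℝ) else 0) = Pi.single i 1 :=
      fun i => by ext j; simp [Pi.single_apply, eq_comm]
    simp only [hsingle, LinearMap.comp_apply, LinearEquiv.coe_coe, LinearEquiv.apply_symm_apply,
      T, trilinearOfThreeForm_apply, smul_eq_mul] at this
    rw [this, hB, hcross, LinearEquiv.symm_apply_apply, dotProduct]
    exact Finset.sum_congr rfl fun i _ => mul_comm _ _
  refine ⟨B, ⟨fun u v => by rw [hB, hB, dotProduct_comm], fun u hu => ?_⟩, cross, hφB, fun u v => ?_,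
    fun u v => ?_, fun u v => ?_, fun u v => ?_⟩
  · rw [hB]
    refine lt_of_le_of_ne (Finset.sum_nonneg fun i _ => mul_self_nonneg _) (Ne.symm ?_)
    rw [Ne, dotProduct_self_eq_zero]
    simpa using hu
  · rw [hcross, hcross, ← map_neg]
    congr 1
    ext i
    exact threeForm_swap_left _ _ _ _
  · rw [← hφB, threeForm_self_outer]
  · rw [← hφB, threeForm_self_right]
  · obtain ⟨x, rfl⟩ := L.surjective u
    obtain ⟨y, rfl⟩ := L.surjective v
    simp only [hB, hcross, LinearEquiv.symm_apply_apply, hL]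
    simp [dotProduct, Fin.sum_univ_seven, frameForm, minorThree]
    ring

theorem IsCompatibleInnerProduct.isNondegenerateThreeForm {φ : V [⋀^Fin 3]→ₗ[ℝ] ℝ}
    {B : V →ₗ[ℝ] V →ₗ[ℝ] ℝ} (h : IsCompatibleInnerProduct φ B) :
    IsNondegenerateThreeForm φ := by
  obtain ⟨⟨hsymm, hpos⟩, cross, hφ, hcross⟩ := h
  intro u v huv
  refine ⟨cross u v, fun h0 => ?_⟩
  rw [hφ, hcross.area] at h0
  have hu : u ≠ 0 := huv.ne_zero 0
  -- The squared norm of this vector is |u|² times the Gram determinant of u and v.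
  have hw : B (B u u • v - B u v • u) (B u u • v - B u v • u) = 0 := by
    simp only [map_sub, map_smul, LinearMap.sub_apply, LinearMap.smul_apply, smul_eq_mul,
      hsymm v u]
    linear_combination B u u * h0
  have hw0 : B u u • v - B u v • u = 0 := by
    by_contra hne
    exact (hpos _ hne).ne' hw
  have := (LinearIndependent.pair_iff.1 huv (-B u v) (B u u) (by rw [← hw0]; module)).2
  exact (hpos u hu).ne' this

end NormalForm

/-! ### Eigenvectors of one form relative to another. -/

section Eigenvectors

variable {V : Type*} [AddCommGroup V] [Module ℝ V]

/-- A symmetric bilinear form has an eigenvector relative to an inner product on any nonzero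
orthogonal complement of a family of eigenvectors. -/
theorem IsInnerProduct.exists_eigenvector [FiniteDimensional ℝ V] {B B' : V →ₗ[ℝ] V →ₗ[ℝ] ℝ}
    (hB : IsInnerProduct B) (hB' : ∀ u v, B' u v = B' v u) {ι : Type*} {a : ι → V} {s : ι → ℝ}
    (ha : ∀ i y, B' (a i) y = s i * B (a i) y) (hne : ∃ z ≠ 0, ∀ i, B (a i) z = 0) :
    ∃ x ≠ 0, (∀ i, B (a i) x = 0) ∧ ∃ r, ∀ y, B' x y = r * B x y := by
  let core : InnerProductSpace.Core ℝ V :=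
    { inner := fun x y => B x y
      conj_inner_symm := fun x y => hB.symm y x
      re_inner_nonneg := fun x => by
        rcases eq_or_ne x 0 with rfl | hx
        · simp
        · exact (hB.pos x hx).le
      add_left := fun x y z => by simp
      smul_left := fun x y r => by simp
      definite := fun x hx => by
        by_contra hne
        exact (hB.pos x hne).ne' hx }
  let _ : NormedAddCommGroup V := core.toNormedAddCommGroup
  let _ : InnerProductSpace ℝ V := InnerProductSpace.ofCore core.toCore
  have hinner : ∀ x y : V, inner ℝ x y = B x y := fun x y => rfl
  have hinj : Function.Injective B := by
    rw [injective_iff_map_eq_zero]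
    intro x hx
    by_contra hne
    exact (hB.pos x hne).ne' (by rw [hx, LinearMap.zero_apply])
  let E : V ≃ₗ[ℝ] Module.Dual ℝ V :=
    LinearMap.linearEquivOfInjective B hinj Subspace.dual_finrank_eq.symm
  -- The self-adjoint operator representing `B'`; it preserves the orthogonal complement of
  -- eigenvectors, so the spectral theorem applies there.
  let S : V →ₗ[ℝ] V := E.symm.toLinearMap ∘ₗ B'
  have hS : ∀ x y, B (S x) y = B' x y := fun x y =>
    congrArg (fun f : Module.Dual ℝ V => f y) (E.apply_symm_apply (B' x))
  let U : Submodule ℝ V := ⨅ i, LinearMap.ker (B (a i))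
  have hU : ∀ x, x ∈ U ↔ ∀ i, B (a i) x = 0 := fun x => by simp [U, Submodule.mem_iInf]
  have hSU : ∀ x ∈ U, S x ∈ U := fun x hx => by
    rw [hU] at hx ⊢
    intro i
    rw [hB.symm, hS, hB', ha, hx, mul_zero]
  have hSsymm : S.IsSymmetric := fun x y => by
    rw [hinner, hinner, hS, hB.symm x, hS, hB']
  have hSUsymm := hSsymm.restrict_invariant hSU
  by_contra! hno
  have hsub : Subsingleton U := by
    refine hSUsymm.subsingleton_of_no_eigenvalue_finiteDimensional fun r => ?_
    by_contra hr
    obtain ⟨x, hx⟩ := Module.End.HasEigenvalue.exists_hasEigenvector hr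
    have hx0 : (x : V) ≠ 0 := fun h => hx.2 (Subtype.ext h)
    obtain ⟨y, hy⟩ := hno x hx0 ((hU x).1 x.2) r
    apply hy
    have hSx : S x = r • (x : V) := congrArg Subtype.val hx.apply_eq_smul
    rw [← hS, hSx, map_smul, LinearMap.smul_apply, smul_eq_mul]
  obtain ⟨z, hz0, hz⟩ := hne
  exact hz0 (congrArg Subtype.val (Subsingleton.elim (⟨z, (hU z).2 hz⟩ : U) 0))

/-- A finite family with fewer than `finrank ℝ V` members has a nonzero orthogonal vector. -/
theorem exists_ne_zero_orthogonal [FiniteDimensional ℝ V] (B : V →ₗ[ℝ] V →ₗ[ℝ] ℝ) {n : ℕ}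
    (hn : n < Module.finrank ℝ V) (a : Fin n → V) : ∃ z ≠ 0, ∀ i, B (a i) z = 0 := by
  let A : V →ₗ[ℝ] (Fin n → ℝ) := LinearMap.pi fun i => B (a i)
  obtain ⟨z, hzA, hz⟩ : ∃ z ∈ LinearMap.ker A, z ≠ 0 :=
    (Submodule.ne_bot_iff _).1 (LinearMap.ker_ne_bot_of_finrank_lt (by simpa using hn))
  exact ⟨z, hz, fun i => congrFun hzA i⟩

end Eigenvectors

/-! ### Cross product identities and uniqueness. -/

section CrossProduct

variable {V : Type*} [AddCommGroup V] [Module ℝ V] {φ : V [⋀^Fin 3]→ₗ[ℝ] ℝ}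
  {B B' : V →ₗ[ℝ] V →ₗ[ℝ] ℝ} {cross cross' : V →ₗ[ℝ] V →ₗ[ℝ] V}

theorem IsInnerProduct.ext_left (hB : IsInnerProduct B) {x y : V} (h : ∀ z, B x z = B y z) :
    x = y := by
  by_contra hne
  refine (hB.pos _ (sub_ne_zero.2 hne)).ne' ?_
  rw [LinearMap.map_sub₂, h, sub_self]

theorem cross_cross_self (hB : IsInnerProduct B) (hφ : ∀ u v w, φ ![u, v, w] = B (cross u v) w)
    (hcross : IsCrossProduct B cross) (u v : V) :
    cross u (cross u v) = -(B u u) • v + B u v • u := by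
  refine hB.ext_left fun z => ?_
  have hpol : B (cross u v) (cross u z) = B u u * B v z - B u v * B u z := by
    have h := hcross.area u (v + z)
    simp only [map_add, LinearMap.add_apply] at h
    rw [hcross.area, hcross.area, hB.symm (cross u z), hB.symm z v] at h
    linear_combination h / 2
  rw [← hφ, threeForm_swap_right, hφ, hB.symm, hpol]
  simp only [map_add, map_smul, LinearMap.add_apply, LinearMap.smul_apply, smul_eq_mul]
  ring

/-- Polarization of `cross_cross_self` in its first argument; orthogonality kills the right-hand
side. -/
theorem cross_cross_swap (hB : IsInnerProduct B) (hφ : ∀ u v w, φ ![u, v, w] = B (cross u v) w)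
    (hcross : IsCrossProduct B cross) {u v x : V} (huv : B u v = 0) (hux : B u x = 0)
    (hvx : B v x = 0) : cross u (cross v x) = -cross v (cross u x) := by
  have h := cross_cross_self hB hφ hcross (u + v) x
  simp only [map_add, LinearMap.add_apply, cross_cross_self hB hφ hcross u x,
    cross_cross_self hB hφ hcross v x, hB.symm v u, huv, hux, hvx] at h
  rw [eq_neg_iff_add_eq_zero]
  simp only [zero_smul, add_zero, zero_add] at h
  rw [← sub_eq_zero] at h
  rw [← h]
  module

theorem cross_cross_assoc (hB : IsInnerProduct B) (hφ : ∀ u v w, φ ![u, v, w] = B (cross u v) w)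
    (hcross : IsCrossProduct B cross) {u v x : V} (huv : B u v = 0) (hux : B u x = 0)
    (hvx : B v x = 0) : cross (cross u v) x = -cross u (cross v x) := by
  rw [hcross.skew, cross_cross_swap hB hφ hcross ((hB.symm _ _).trans hux)
    ((hB.symm _ _).trans hvx) huv, neg_neg, hcross.skew x v, map_neg]

theorem IsInnerProduct.eigenvalue_pos (hB : IsInnerProduct B) (hB' : IsInnerProduct B') {u : V}
    {s : ℝ} (hu : u ≠ 0) (hs : ∀ y, B' u y = s * B u y) : 0 < s := by
  have := hs u
  exact pos_of_mul_pos_left (this ▸ hB'.pos u hu) (hB.pos u hu).le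

/-- The cross product of two orthogonal eigenvectors is an eigenvector. -/
theorem cross_eigenvector (hB : IsInnerProduct B) (hB' : IsInnerProduct B')
    (hφ : ∀ u v w, φ ![u, v, w] = B (cross u v) w)
    (hφ' : ∀ u v w, φ ![u, v, w] = B' (cross' u v) w)
    (hcross : IsCrossProduct B cross) (hcross' : IsCrossProduct B' cross') {u v : V} {s t : ℝ}
    (hu : u ≠ 0) (hv : v ≠ 0) (hs : ∀ y, B' u y = s * B u y) (ht : ∀ y, B' v y = t * B v y)
    (huv : B u v = 0) (y : V) : B' (cross u v) y = (s * t)⁻¹ * B (cross u v) y := by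
  have hs0 := hB.eigenvalue_pos hB' hu hs
  have ht0 := hB.eigenvalue_pos hB' hv ht
  have huv' : B' u v = 0 := by rw [hs, huv, mul_zero]
  have hcc' := cross_cross_self hB' hφ' hcross' u v
  rw [huv', zero_smul, add_zero] at hcc'
  -- Both products represent φ, so the outer `cross` can be traded for `cross'` after pairing with
  -- z. A second `cross u` will then give u ×' v = st (u × v).
  have hcc : cross u (cross' u v) = -(s * t * B u u) • v := by
    refine hB.ext_left fun z => ?_
    rw [← hφ, hφ', hcc']
    simp only [map_smul, LinearMap.smul_apply, smul_eq_mul, hs, ht]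
    ring
  have horth : B u (cross' u v) = 0 := by
    have := hcross'.orth_left u v
    rw [hB'.symm, hs] at this
    exact (mul_eq_zero.1 this).resolve_left hs0.ne'
  have hccc := cross_cross_self hB hφ hcross u (cross' u v)
  rw [hcc, horth, zero_smul, add_zero, map_smul] at hccc
  have heq : cross' u v = (s * t) • cross u v := by
    have huu := (hB.pos u hu).ne'
    refine smul_right_injective V huu ?_
    simp only [neg_smul, neg_inj] at hccc
    change B u u • cross' u v = B u u • (s * t) • cross u v
    rw [← hccc, smul_smul, mul_comm]
  have h := (hφ u v y).symm.trans (hφ' u v y)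
  rw [h, heq, map_smul, LinearMap.smul_apply, smul_eq_mul]
  field_simp

theorem cross_ne_zero (hB : IsInnerProduct B) (hcross : IsCrossProduct B cross) {u v : V}
    (hu : u ≠ 0) (hv : v ≠ 0) (huv : B u v = 0) : cross u v ≠ 0 := by
  intro h
  have := hcross.area u v
  simp only [h, huv, map_zero] at this
  have := mul_pos (hB.pos u hu) (hB.pos v hv)
  linarith

/-- Up to sign, (u × v) × x and u × (v × x) are one nonzero vector, whose eigenvalue is both st / r
and tr / s; hence s² = r². -/
theorem eigenvalue_eq_of_triple (hB : IsInnerProduct B) (hB' : IsInnerProduct B')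
    (hφ : ∀ u v w, φ ![u, v, w] = B (cross u v) w)
    (hφ' : ∀ u v w, φ ![u, v, w] = B' (cross' u v) w)
    (hcross : IsCrossProduct B cross) (hcross' : IsCrossProduct B' cross') {u v x : V}
    {s t r : ℝ} (hu : u ≠ 0) (hv : v ≠ 0) (hx : x ≠ 0) (hs : ∀ y, B' u y = s * B u y)
    (ht : ∀ y, B' v y = t * B v y) (hr : ∀ y, B' x y = r * B x y)
    (huv : B u v = 0) (hux : B u x = 0) (hvx : B v x = 0) (huvx : B (cross u v) x = 0) :
    s = r := by
  have hs0 := hB.eigenvalue_pos hB' hu hs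
  have ht0 := hB.eigenvalue_pos hB' hv ht
  have hr0 := hB.eigenvalue_pos hB' hx hr
  have hE := @cross_eigenvector _ _ _ φ B B' cross cross' hB hB' hφ hφ' hcross hcross'
  have horth : B u (cross v x) = 0 := by
    rw [hB.symm, ← hφ, ← threeForm_cycle, hφ, huvx]
  have h1 := hE hu (cross_ne_zero hB hcross hv hx hvx) hs (hE hv hx ht hr hvx) horth
  have h2 := hE (cross_ne_zero hB hcross hu hv huv) hx (hE hu hv hs ht huv) hr huvx
  have hne := cross_ne_zero hB hcross hu (cross_ne_zero hB hcross hv hx hvx) horth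
  rw [cross_cross_assoc hB hφ hcross huv hux hvx] at h2
  set w := cross u (cross v x)
  have h1w := h1 w
  have h2w := h2 w
  simp only [map_neg, LinearMap.neg_apply, mul_neg, neg_inj] at h2w
  have heq := mul_right_cancel₀ (hB.pos w hne).ne' (h1w.symm.trans h2w)
  field_simp at heq
  have hsq : s ^ 2 = r ^ 2 := by linear_combination -heq
  exact (pow_left_inj₀ hs0.le hr0.le two_ne_zero).1 hsq

theorem IsCompatibleInnerProduct.eigenvalue_eq_one (hV : Module.finrank ℝ V = 7)
    (h : IsCompatibleInnerProduct φ B) (h' : IsCompatibleInnerProduct φ B') {u : V} {s : ℝ}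
    (hu : u ≠ 0) (hs : ∀ y, B' u y = s * B u y) : s = 1 := by
  have : FiniteDimensional ℝ V := Module.finite_of_finrank_pos (by omega)
  obtain ⟨hB, cross, hφ, hcross⟩ := h
  obtain ⟨hB', cross', hφ', hcross'⟩ := h'
  obtain ⟨v, hv, huv, t, ht⟩ := hB.exists_eigenvector hB'.symm (a := fun _ : Fin 1 => u)
    (s := fun _ => s) (fun _ => hs) (exists_ne_zero_orthogonal B (by omega) _)
  replace huv := huv 0
  have hw := cross_eigenvector hB hB' hφ hφ' hcross hcross' hu hv hs ht huv
  have hw0 := cross_ne_zero hB hcross hu hv huv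
  obtain ⟨x, hx, horth, r, hr⟩ := hB.exists_eigenvector hB'.symm (a := ![u, v, cross u v])
    (s := ![s, t, (s * t)⁻¹]) (fun i => by fin_cases i <;> assumption)
    (exists_ne_zero_orthogonal B (by omega) _)
  have hux : B u x = 0 := horth 0
  have hvx : B v x = 0 := horth 1
  have hwx : B (cross u v) x = 0 := horth 2
  have huw : B u (cross u v) = 0 := (hB.symm _ _).trans (hcross.orth_left u v)
  have hT := @eigenvalue_eq_of_triple _ _ _ φ B B' cross cross' hB hB' hφ hφ' hcross hcross'
  have hsr : s = r := hT hu hv hx hs ht hr huv hux hvx hwx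
  have htr : t = r := hT hv hu hx ht hs hr ((hB.symm _ _).trans huv) hvx hux
    (by rw [hcross.skew, map_neg, LinearMap.neg_apply, hwx, neg_zero])
  have hwr : (s * t)⁻¹ = r := hT hw0 hu hx hw hs hr ((hB.symm _ _).trans huw) hwx hux (by
    rw [hcross.skew, cross_cross_self hB hφ hcross, huv, zero_smul, add_zero]
    simp [hvx])
  have hs0 := hB.eigenvalue_pos hB' hu hs
  have hcube : s ^ 3 = 1 := by
    rw [htr, ← hsr] at hwr
    field_simp at hwr
    linear_combination -hwr
  exact (pow_eq_one_iff_of_nonneg hs0.le three_ne_zero).1 hcube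

theorem IsCompatibleInnerProduct.unique (hV : Module.finrank ℝ V = 7)
    (h : IsCompatibleInnerProduct φ B) (h' : IsCompatibleInnerProduct φ B') : B = B' := by
  have : FiniteDimensional ℝ V := Module.finite_of_finrank_pos (by omega)
  have hB := h.1
  let K : Submodule ℝ V := LinearMap.ker (B' - B)
  have hK : ∀ x ∈ K, ∀ y, B' x y = B x y := fun x hx y =>
    sub_eq_zero.1 (congrArg (fun f : V →ₗ[ℝ] ℝ => f y) hx)
  -- A nonzero complement of `K` would contain an eigenvector; its eigenvalue is 1, so it would lie
  -- in `K` and be orthogonal to itself.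
  have hnone : ¬ ∃ z ≠ 0, ∀ a : K, B (a : V) z = 0 := by
    intro hz
    obtain ⟨x, hx, hKx, r, hr⟩ := hB.exists_eigenvector h'.1.symm (a := fun a : K => (a : V))
      (s := fun _ => 1) (fun a y => by rw [hK a a.2, one_mul]) hz
    have hr1 := h.eigenvalue_eq_one hV h' hx hr
    have hxK : x ∈ K := by
      rw [LinearMap.mem_ker]
      ext y
      simp [hr, hr1]
    exact (hB.pos x hx).ne' (hKx ⟨x, hxK⟩)
  let A : V →ₗ[ℝ] Module.Dual ℝ K := K.dualRestrict ∘ₗ B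
  have hA : Function.Injective A := by
    rw [injective_iff_map_eq_zero]
    intro z hz
    by_contra hz0
    exact hnone ⟨z, hz0, fun a =>
      (hB.symm _ _).trans (congrArg (fun f : Module.Dual ℝ K => f a) hz)⟩
  have hle := LinearMap.finrank_le_finrank_of_injective hA
  rw [Subspace.dual_finrank_eq] at hle
  have htop : K = ⊤ := Submodule.eq_top_of_finrank_eq (le_antisymm K.finrank_le hle)
  ext x y
  exact (hK x (htop ▸ Submodule.mem_top) y).symm

end CrossProduct

theorem theorem3p2 {V : Type*} [AddCommGroup V] [Module ℝ V] (hV : Module.finrank ℝ V = 7)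
    (φ φ' : V [⋀^Fin 3]→ₗ[ℝ] ℝ) :
    (IsNondegenerateThreeForm φ ↔
      ∃ B : V →ₗ[ℝ] V →ₗ[ℝ] ℝ, IsCompatibleInnerProduct φ B) ∧
    (∀ B B' : V →ₗ[ℝ] V →ₗ[ℝ] ℝ,
      IsCompatibleInnerProduct φ B → IsCompatibleInnerProduct φ B' → B = B') ∧
    (IsNondegenerateThreeForm φ → IsNondegenerateThreeForm φ' →
      ∃ g : V ≃ₗ[ℝ] V, φ.compLinearMap (g : V →ₗ[ℝ] V) = φ') :=
  ⟨⟨fun h => h.exists_isCompatibleInnerProduct hV,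
      fun ⟨_, h⟩ => h.isNondegenerateThreeForm⟩,
    fun _ _ h h' => h.unique hV h', fun h h' => h.exists_compLinearMap_eq hV h'⟩
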